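/- Let $M$ be a finite loopless matroid with ground set $E$, rank function $r$ and positive rank $r(M)=r(E)>0$. For $A\subseteq E$, $M/A$ denotes contraction. For an integer $1\le t\le r(M)$, the $t$-truncation $M_t$ is the matroid on $E$ whose independent sets are the independent sets of $M$ with at most $t$ elements. The universal density $\eta^*_M\in\mathbb R^E$ of $M$ is the vector that, for every $1<p<\infty$, is the unique minimizer of $\|\eta\|_p$ over the convex hull of the indicator vectors of the bases of $M$ (such a vector exists). $M$ is homogeneous if $\eta^*_M$ is constant, and the balancity of $M$ is the largest integer $t$ with $1\le t\le r(M)$ such that $M_t$ is homogeneous. The blocks of the principal partition of $M$ are the nonempty sets of the form $U_\mu\setminus L_\mu$, $\mu\in\mathbb R$, where $U_\mu$ and $L_\mu$ are the largest and the smallest minimizer of $X\mapsto r(X)-\mu|X|$ over the subsets $X\subseteq E$. Let $s_1<s_2<\dots<s_k$ be the distinct values of $\eta^*=\eta^*_M$. For $i=1,\dots,k$ put $E_i=\{e\in E:\eta^*(e)\ge s_i\}$, $b_i=\lfloor |E_i|s_i\rfloor$ and $c_i=b_i+r(E-E_i)$, and put $c_0=0$. For $t=1,\dots,r(M)$ let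 $\eta^*_t$ be the universal density of $M_t$. Then: (i) $b_i$ is the balancity of $M/(E-E_i)$ for $i=1,\dots,k$; (ii) $0=c_0<c_1\le c_2\le\dots\le c_{k-1}<c_k=r(M)$; (iii) $c_i-b_i=r(E-E_i)\le c_{i-1}$ for $i=1,\dots,k$; (iv) for $i=1,\dots,k$ and every integer $t$ with $c_{i-1}<t\le c_i$, $$\eta^*_t(e)=\begin{cases}\dfrac{t-r(E-E_i)}{|E_i|} & \text{if } e\in E_i,\\[2mm] \eta^*(e) & \text{if } e\in E-E_i.\end{cases}$$ Consequently, for $c_{i-1}<t\le c_i$ the blocks of the principal partition of $M_t$ are the sets $\{e\in E:\eta^*(e)=s_j\}$ for $1\le j<i$, together with $E_i$. -/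

import Mathlib

open Set

namespace BaseModulus

variable {α : Type*}

/-- The rank `r(X)` of a set `X` as a natural number. -/
noncomputable def rk (M : Matroid α) (X : Set α) : ℕ := (M.eRk X).toNat

/-- The `t`-truncation `M_t`: the matroid on the ground set of `M` whose independent sets are the
independent sets of `M` with at most `t` elements. -/
def truncation (M : Matroid α) (t : ℕ) : Matroid α :=
  (IndepMatroid.ofBddAugment M.E (fun I => M.Indep I ∧ I.encard ≤ t)
    ⟨M.empty_indep, by simp⟩
    (fun _ _ hJ hIJ => ⟨hJ.1.subset hIJ, (encard_le_encard hIJ).trans hJ.2⟩)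
    (by
      intro I J hI hJ hlt
      obtain ⟨e, he, heI⟩ := hI.1.augment hJ.1 hlt
      refine ⟨e, he.1, he.2, heI, ?_⟩
      rw [encard_insert_of_notMem he.2]
      exact (Order.add_one_le_of_lt hlt).trans hJ.2)
    ⟨t, fun _ hI => hI.2⟩
    (fun _ hI => hI.1.subset_ground)).matroid

@[simp] theorem truncation_ground (M : Matroid α) (t : ℕ) : (truncation M t).E = M.E := rfl

@[simp] theorem truncation_indep_iff (M : Matroid α) (t : ℕ) (I : Set α) :
    (truncation M t).Indep I ↔ M.Indep I ∧ I.encard ≤ t := by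
  simp [truncation]

/-- `conv(𝓑(M))`: the convex hull of the indicator vectors of the bases of `M`. Vectors indexed by
the ground set are represented by functions on `α`; members of `conv(𝓑(M))` vanish off `M.E`. -/
def basePolytope (M : Matroid α) : Set (α → ℝ) :=
  convexHull ℝ ((fun B : Set α => B.indicator (fun _ => (1 : ℝ))) '' {B | M.IsBase B})

/-- The `p`-norm of a vector indexed by the (finite) ground set of `M`. -/
noncomputable def pNorm (M : Matroid α) (p : ℝ) (η : α → ℝ) : ℝ :=
  (∑ᶠ e ∈ M.E, |η e| ^ p) ^ (1 / p)

/-- `η` is the universal density of `M`: for every `1 < p < ∞` it is the unique vector of least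
`p`-norm in `conv(𝓑(M))`. -/
def IsUniversalDensity (M : Matroid α) (η : α → ℝ) : Prop :=
  η ∈ basePolytope M ∧
    ∀ p : ℝ, 1 < p → ∀ ζ ∈ basePolytope M, ζ ≠ η → pNorm M p η < pNorm M p ζ

/-- `M` is homogeneous: its universal density is constant on the ground set. -/
def IsHomogeneous (M : Matroid α) : Prop :=
  ∃ η, IsUniversalDensity M η ∧ ∃ a : ℝ, ∀ e ∈ M.E, η e = a

/-- `b` is the balancity of `M`: the largest integer `1 ≤ t ≤ r(M)` for which `M_t` is
homogeneous. -/
def IsBalancity (M : Matroid α) (b : ℕ) : Prop :=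
  IsGreatest {t : ℕ | 1 ≤ t ∧ t ≤ rk M M.E ∧ IsHomogeneous (truncation M t)} b

/-- The sets `X ⊆ E` that minimize `r(X) - μ |X|`. For finite `M` they form a lattice. -/
def minimizers (M : Matroid α) (μ : ℝ) : Set (Set α) :=
  {X | X ⊆ M.E ∧ ∀ Y ⊆ M.E, (rk M X : ℝ) - μ * X.ncard ≤ (rk M Y : ℝ) - μ * Y.ncard}

/-- The blocks of the principal partition of `M`: the nonempty differences between the largest and
the smallest minimizer of `r(X) - μ |X|`, where `μ` ranges over the reals. -/
def principalPartition (M : Matroid α) : Set (Set α) :=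
  {P | P.Nonempty ∧ ∃ μ : ℝ, P = ⋃₀ minimizers M μ \ ⋂₀ minimizers M μ}

end BaseModulus

open BaseModulus

namespace BaseModulus

open scoped Classical

variable {α : Type*}

/-! Everything rests on a combinatorial criterion for the universal density: a vector `η` of the
base polytope is universally optimal iff `∑ e ∈ X, η e = r(X)` for every strict lower level set `X`
of `η` (`isUniversalDensity_iff_isLevelTight`). If `η` is tight in this sense and `ζ` lies in the
polytope, then `ζ - η` has nonpositive sum over each lower level set and total zero. Abel summation
against the increasing weight `η ^ (p - 1)` gives the first-order optimality condition for all `p >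
1` at once, and strict convexity finishes. Conversely, a minimizer of the 2-norm is a mixture of
bases of minimum `η`-weight, and the greedy exchange argument shows that such bases span every lower
level set.

Tightness transfers easily. Capping `η` at the height `v` for which the total becomes `t` gives a
tight vector for `M_t`; deleting a lower level set from `η` gives a tight vector for the
contraction. The level sets of a tight vector are the blocks of the principal partition, since `∑ e
∈ X, (η e - μ)` bounds `r(X) - μ|X|` from below, with equality on lower level sets. Testing the
lowest level set shows that `M_t` is homogeneous iff `t ≤ |E| · min η`, which gives the balancity.

What remains is arithmetic: `c i` is the integer part of `|E i| s i + r(E - E i) = ∑ min (η e) (s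
i)`, so `c (i - 1) < t ≤ c i` says exactly that the cap for `t` lies in `(s (i - 1), s i]` (for `i =
1`, in `(0, s 1]`). -/

/-- The ground set of a finite matroid as a finset. -/
noncomputable def groundFinset (M : Matroid α) [M.Finite] : Finset α := M.ground_finite.toFinset

@[simp] theorem coe_groundFinset (M : Matroid α) [M.Finite] : (groundFinset M : Set α) = M.E := by
  simp [groundFinset]

@[simp] theorem mem_groundFinset {M : Matroid α} [M.Finite] {e : α} :
    e ∈ groundFinset M ↔ e ∈ M.E := by
  simp [groundFinset]

theorem coe_subset_ground {M : Matroid α} [M.Finite] {X : Finset α} (h : X ⊆ groundFinset M) :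
    (X : Set α) ⊆ M.E := by
  rw [← coe_groundFinset]
  exact_mod_cast h

/-! ### Abel summation over lower level sets -/

/-- `X` is a strict lower level set of the weight `w` on `S`. -/
def IsLowerPart (S : Finset α) (w : α → ℝ) (X : Finset α) : Prop :=
  X ⊆ S ∧ ∀ e ∈ X, ∀ f ∈ S, f ∉ X → w e < w f

theorem isLowerPart_self (S : Finset α) (w : α → ℝ) : IsLowerPart S w S :=
  ⟨subset_rfl, fun _ _ _ hf hf' => (hf' hf).elim⟩

theorem isLowerPart_filter_lt (S : Finset α) (w : α → ℝ) (a : ℝ) :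
    IsLowerPart S w (S.filter (fun e => w e < a)) := by
  refine ⟨Finset.filter_subset _ _, fun e he f hf hf' => ?_⟩
  simp only [Finset.mem_filter, hf, true_and, not_lt] at he hf'
  exact he.2.trans_le hf'

theorem isLowerPart_filter_le (S : Finset α) (w : α → ℝ) (a : ℝ) :
    IsLowerPart S w (S.filter (fun e => w e ≤ a)) := by
  refine ⟨Finset.filter_subset _ _, fun e he f hf hf' => ?_⟩
  simp only [Finset.mem_filter, hf, true_and, not_le] at he hf'
  exact he.2.trans_lt hf'

/-- Abel summation, peeling off the top level of `w`; what is left is a lower level set, and so are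
its own lower parts. The free bound `C` lets the induction hypothesis be used with the value of the
removed level. -/
theorem mul_sum_le_sum_mul_of_lowerPart (w d : α → ℝ) : ∀ (n : ℕ) (S : Finset α) (C : ℝ),
    S.card = n → (∀ X, IsLowerPart S w X → ∑ e ∈ X, d e ≤ 0) → (∀ e ∈ S, w e ≤ C) →
    C * ∑ e ∈ S, d e ≤ ∑ e ∈ S, w e * d e := by
  intro n
  induction n using Nat.strong_induction_on with
  | _ n ih =>
    intro S C hn hd hC
    obtain rfl | hS := S.eq_empty_or_nonempty
    · simp
    obtain ⟨m, hm, hmax⟩ := S.exists_max_image w hS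
    set T := S.filter (fun e => w e < w m) with hT
    have hTS : T ⊆ S := Finset.filter_subset _ _
    have hlt : T.card < n := by
      rw [← hn]
      exact Finset.card_lt_card ⟨hTS, fun h => by simpa [hT] using h hm⟩
    have hTd := ih _ hlt T (w m) rfl (fun X hX => hd X ⟨hX.1.trans hTS, fun e he f hf hf' => by
      by_cases hfT : f ∈ T
      · exact hX.2 e he f hfT hf'
      · have he' := hX.1 he
        simp only [hT, Finset.mem_filter, hf, true_and, not_lt] at he' hfT
        exact he'.2.trans_le hfT⟩) (fun e he => (Finset.mem_filter.1 he).2.le)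
    have h1 : ∑ e ∈ S \ T, w e * d e = w m * ∑ e ∈ S \ T, d e := by
      rw [Finset.mul_sum]
      refine Finset.sum_congr rfl fun e he => ?_
      simp only [hT, Finset.mem_sdiff, Finset.mem_filter, not_and, not_lt] at he
      rw [le_antisymm (hmax e he.1) (he.2 he.1)]
    have h2 := Finset.sum_sdiff (f := fun e => w e * d e) hTS
    have h3 := Finset.sum_sdiff (f := d) hTS
    have h4 := hd S (isLowerPart_self S w)
    have h5 := mul_le_mul_of_nonpos_right (hC m hm) h4
    calc C * ∑ e ∈ S, d e ≤ w m * ∑ e ∈ S, d e := h5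
      _ = w m * ∑ e ∈ S \ T, d e + w m * ∑ e ∈ T, d e := by rw [← h3]; ring
      _ ≤ _ := by rw [← h2, h1]; linarith

theorem sum_mul_nonneg_of_lowerPart {S : Finset α} {w d : α → ℝ}
    (hd : ∀ X, IsLowerPart S w X → ∑ e ∈ X, d e ≤ 0) (h0 : ∑ e ∈ S, d e = 0) :
    0 ≤ ∑ e ∈ S, w e * d e := by
  obtain ⟨C, hC⟩ : ∃ C, ∀ e ∈ S, w e ≤ C := by
    obtain ⟨C, hC⟩ := (S.image w).bddAbove
    exact ⟨C, fun e he => hC (by simpa using ⟨e, he, rfl⟩)⟩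
  have := mul_sum_le_sum_mul_of_lowerPart w d _ S C rfl hd hC
  rwa [h0, mul_zero] at this

/-! ### Rank -/

theorem coe_rk (M : Matroid α) [M.Finite] (X : Set α) : (rk M X : ℕ∞) = M.eRk X := by
  apply ENat.natCast_toNat
  rw [Matroid.eRk_ne_top_iff]
  exact M.isRkFinite_set X

theorem rk_mono (M : Matroid α) [M.Finite] {X Y : Set α} (h : X ⊆ Y) : rk M X ≤ rk M Y := by
  have := M.eRk_mono h
  rw [← coe_rk, ← coe_rk] at this
  exact_mod_cast this

@[simp] theorem rk_empty (M : Matroid α) : rk M ∅ = 0 := by simp [rk]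

theorem ncard_le_rk {M : Matroid α} [M.Finite] {I X : Set α} (hI : M.Indep I) (h : I ⊆ X) :
    I.ncard ≤ rk M X := by
  have := hI.encard_le_eRk_of_subset h
  rw [← coe_rk, ← hI.finite.cast_ncard_eq] at this
  exact_mod_cast this

theorem rk_ground_eq_ncard {M : Matroid α} [M.Finite] {B : Set α} (hB : M.IsBase B) :
    rk M M.E = B.ncard := by
  have := hB.encard_eq_eRank
  rw [← M.eRk_ground, ← coe_rk, ← hB.finite.cast_ncard_eq] at this
  exact_mod_cast this.symm

/-- Extend a basis of `F` to a basis `I` of `X ∪ F`; then `I \ F` is a basis of `X` in the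
contraction. -/
theorem rk_contract_add (M : Matroid α) [M.Finite] {F X : Set α} (hF : F ⊆ M.E)
    (hX : X ⊆ M.E \ F) : rk (M.contract F) X + rk M F = rk M (X ∪ F) := by
  obtain ⟨J, hJ⟩ := M.exists_isBasis F
  obtain ⟨I, hI, hJI⟩ := hJ.indep.subset_isBasis_of_subset
    (hJ.subset.trans (subset_union_right (s := X)))
    (union_subset (hX.trans sdiff_subset) hF)
  have hIF : I ∩ F = J :=
    (hJ.eq_of_subset_indep (hI.indep.inter_right F) (subset_inter hJI hJ.subset)
      inter_subset_right).symm
  have hXF : (X ∪ F) \ F = X := by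
    rw [union_sdiff_right, (subset_sdiff.1 hX).2.sdiff_eq_left]
  have h1 : (M.contract F).IsBasis (I \ F) X := by
    have := hI.contract_isBasis hJ (by rw [← hIF, sdiff_union_inter]; exact hI.indep)
    rwa [hXF] at this
  have h2 := encard_sdiff_add_encard_inter I F
  rw [hIF, h1.encard_eq_eRk, hJ.encard_eq_eRk, hI.encard_eq_eRk, ← coe_rk, ← coe_rk, ← coe_rk] at h2
  exact_mod_cast h2

instance (M : Matroid α) [M.Finite] (t : ℕ) : (truncation M t).Finite := ⟨M.ground_finite⟩

theorem rk_truncation (M : Matroid α) [M.Finite] (t : ℕ) (X : Set α) :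
    rk (truncation M t) X = min (rk M X) t := by
  apply le_antisymm
  · obtain ⟨I, hI⟩ := (truncation M t).exists_isBasis' X
    have h := (truncation_indep_iff M t I).1 hI.indep
    have h1 := hI.encard_eq_eRk
    rw [← coe_rk, ← h.1.finite.cast_ncard_eq] at h1
    rw [← Nat.cast_inj.1 h1]
    refine le_min (ncard_le_rk h.1 hI.subset) ?_
    have h2 := h.2
    rw [← h.1.finite.cast_ncard_eq] at h2
    exact_mod_cast h2
  · obtain ⟨I, hI⟩ := M.exists_isBasis' X
    have h1 := hI.encard_eq_eRk
    rw [← coe_rk] at h1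
    obtain ⟨J, hJI, hJ⟩ := exists_subset_encard_eq (s := I) (k := (min (rk M X) t : ℕ))
      (by rw [h1]; exact_mod_cast min_le_left _ _)
    have hJind : (truncation M t).Indep J := by
      rw [truncation_indep_iff, hJ]
      exact ⟨hI.indep.subset hJI, by exact_mod_cast min_le_right _ _⟩
    have h2 := ncard_le_rk hJind (hJI.trans hI.subset)
    rwa [ncard, hJ, ENat.toNat_natCast] at h2

/-! ### The base polytope -/

/-- The indicator vector of a set. -/
noncomputable def indVec (B : Set α) : α → ℝ := B.indicator (fun _ => (1 : ℝ))

theorem sum_indVec (X : Finset α) (B : Set α) :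
    ∑ e ∈ X, indVec B e = ((B ∩ X : Set α).ncard : ℝ) := by
  have : (B ∩ X : Set α) = ((X.filter (fun e => e ∈ B) : Finset α) : Set α) := by
    ext; simp [and_comm]
  rw [this, ncard_coe_finset]
  simp [indVec, indicator_apply]

/-- Greedy exchange: if `B ∩ X` does not span `X`, some `e ∈ X` can be added to it, and completing
from `B` trades `e` for a single `f` outside `X`. That `f` is strictly heavier, contradicting
minimality. -/
theorem ncard_inter_eq_rk_of_min_weight {M : Matroid α} [M.Finite] {w : α → ℝ} {B : Set α}
    (hB : M.IsBase B)
    (hmin : ∀ B', M.IsBase B' →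
      ∑ e ∈ groundFinset M, w e * indVec B e ≤ ∑ e ∈ groundFinset M, w e * indVec B' e)
    {X : Finset α} (hX : IsLowerPart (groundFinset M) w X) :
    (B ∩ X).ncard = rk M X := by
  refine le_antisymm (ncard_le_rk (hB.indep.inter_right _) inter_subset_right) ?_
  by_contra! hlt
  obtain ⟨I, hI⟩ := M.exists_isBasis (X : Set α) (coe_subset_ground hX.1)
  have hlt' : (B ∩ X).encard < I.encard := by
    rw [hI.encard_eq_eRk, ← coe_rk, ← (hB.finite.inter_of_left _).cast_ncard_eq]
    exact_mod_cast hlt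
  obtain ⟨e, he, hind⟩ := (hB.indep.inter_right (X : Set α)).augment hI.indep hlt'
  have heX : e ∈ X := hI.subset he.1
  have heB : e ∉ B := fun h => he.2 ⟨h, heX⟩
  obtain ⟨B', hB', hsub, hsub'⟩ := hind.exists_isBase_subset_union_isBase hB
  have h1 : B' \ B = {e} := by
    ext x
    simp only [mem_sdiff, mem_singleton_iff]
    constructor
    · rintro ⟨hx, hxB⟩
      rcases hsub' hx with (rfl | h) | h
      · rfl
      · exact (hxB h.1).elim
      · exact (hxB h).elim
    · rintro rfl
      exact ⟨hsub (mem_insert _ _), heB⟩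
  have h2 : (B \ B').encard = 1 := by
    rw [hB.encard_sdiff_comm hB', h1, encard_singleton]
  obtain ⟨f, hf⟩ := encard_eq_one.1 h2
  have hfB : f ∈ B \ B' := by rw [hf]; rfl
  have hfX : f ∉ X := fun h => hfB.2 (hsub (mem_insert_of_mem _ ⟨hfB.1, h⟩))
  have hfE : f ∈ M.E := hB.subset_ground hfB.1
  have heE : e ∈ M.E := coe_subset_ground hX.1 heX
  have hw := hX.2 e heX f (by simpa using hfE) hfX
  have hvec : ∀ x, indVec B' x = indVec B x + (if x = e then 1 else 0) - if x = f then 1 else 0 := by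
    intro x
    have a1 : x ∈ B' \ B ↔ x = e := by rw [h1]; rfl
    have a2 : x ∈ B \ B' ↔ x = f := by rw [hf]; rfl
    have hef : e ≠ f := fun h => heB (h ▸ hfB.1)
    simp only [indVec, indicator_apply, mem_sdiff] at *
    by_cases p : x ∈ B <;> by_cases q : x ∈ B' <;> simp only [p, q] at a1 a2 ⊢ <;> simp at a1 a2 <;>
      simp [a1, a2, hef, hef.symm]
  have := hmin B' hB'
  simp only [hvec, mul_sub, mul_add, Finset.sum_sub_distrib, Finset.sum_add_distrib] at this
  simp [heE, hfE] at this
  linarith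

/-- The linear description of the base polytope. -/
structure IsFractionalBase (M : Matroid α) [M.Finite] (η : α → ℝ) : Prop where
  eq_zero : ∀ e ∉ M.E, η e = 0
  sum_le : ∀ X ⊆ groundFinset M, ∑ e ∈ X, η e ≤ rk M X
  sum_ground : ∑ e ∈ groundFinset M, η e = rk M M.E

theorem IsFractionalBase.nonneg {M : Matroid α} [M.Finite] {η : α → ℝ}
    (h : IsFractionalBase M η) (e : α) : 0 ≤ η e := by
  by_cases he : e ∈ M.E
  · have h1 := h.sum_le _ (Finset.erase_subset e _)
    have h2 := Finset.add_sum_erase (groundFinset M) η (by simpa using he)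
    have h3 : rk M ((groundFinset M).erase e : Finset α) ≤ rk M M.E :=
      rk_mono M (coe_subset_ground (Finset.erase_subset e _))
    have h4 : (rk M ((groundFinset M).erase e : Finset α) : ℝ) ≤ rk M M.E := by exact_mod_cast h3
    rw [h.sum_ground] at h2
    linarith
  · rw [h.eq_zero e he]

theorem isFractionalBase_indVec {M : Matroid α} [M.Finite] {B : Set α} (hB : M.IsBase B) :
    IsFractionalBase M (indVec B) where
  eq_zero e he := by
    have : e ∉ B := fun h => he (hB.subset_ground h)
    simp [indVec, this]
  sum_le X _ := by
    rw [sum_indVec]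
    exact_mod_cast ncard_le_rk (hB.indep.inter_right _) inter_subset_right
  sum_ground := by
    rw [sum_indVec, rk_ground_eq_ncard hB, coe_groundFinset, inter_eq_left.2 hB.subset_ground]

theorem convex_isFractionalBase (M : Matroid α) [M.Finite] :
    Convex ℝ {η : α → ℝ | IsFractionalBase M η} := by
  intro x hx y hy a b ha hb hab
  refine ⟨fun e he => ?_, fun X hX => ?_, ?_⟩
  · simp [hx.eq_zero e he, hy.eq_zero e he]
  · simp only [Pi.add_apply, Pi.smul_apply, smul_eq_mul, Finset.sum_add_distrib, ← Finset.mul_sum]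
    calc _ ≤ a * (rk M X : ℝ) + b * rk M X :=
          add_le_add (mul_le_mul_of_nonneg_left (hx.sum_le X hX) ha)
            (mul_le_mul_of_nonneg_left (hy.sum_le X hX) hb)
      _ = _ := by rw [← add_mul, hab, one_mul]
  · simp only [Pi.add_apply, Pi.smul_apply, smul_eq_mul, Finset.sum_add_distrib, ← Finset.mul_sum,
      hx.sum_ground, hy.sum_ground]
    rw [← add_mul, hab, one_mul]

theorem IsFractionalBase.of_mem_basePolytope {M : Matroid α} [M.Finite] {η : α → ℝ}
    (h : η ∈ basePolytope M) : IsFractionalBase M η := by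
  refine convexHull_min ?_ (convex_isFractionalBase M) h
  rintro _ ⟨B, hB, rfl⟩
  exact isFractionalBase_indVec hB

theorem finite_isBase (M : Matroid α) [M.Finite] : {B | M.IsBase B}.Finite :=
  M.ground_finite.finite_subsets.subset fun _ hB => hB.subset_ground

theorem indVec_mem_basePolytope {M : Matroid α} {B : Set α} (hB : M.IsBase B) :
    indVec B ∈ basePolytope M :=
  subset_convexHull _ _ ⟨B, hB, rfl⟩

/-- Edmonds' description of the base polytope. A functional `w` separating `η` from the hull would
make `η` lighter than a base of minimum `w`-weight, but that base attains the rank on the lower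
level sets of `w`, so Abel summation gives the opposite inequality. -/
theorem IsFractionalBase.mem_basePolytope {M : Matroid α} [M.Finite] {η : α → ℝ}
    (h : IsFractionalBase M η) : η ∈ basePolytope M := by
  by_contra hη
  have hfin := (finite_isBase M).image (fun B : Set α => B.indicator (fun _ => (1 : ℝ)))
  obtain ⟨f, u, hfu, hu⟩ := geometric_hahn_banach_point_closed
    (convex_convexHull ℝ _) (hfin.isClosed_convexHull ℝ) hη
  set w : α → ℝ := fun e => f (Pi.single e 1)
  have hf : ∀ x : α → ℝ, (∀ e ∉ M.E, x e = 0) → f x = ∑ e ∈ groundFinset M, w e * x e := by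
    intro x hx
    have : x = ∑ e ∈ groundFinset M, x e • Pi.single e (1 : ℝ) := by
      ext a
      by_cases ha : a ∈ M.E <;> simp [Finset.sum_apply, Pi.single_apply, ha, hx]
    conv_lhs => rw [this]
    simp [w, mul_comm]
  obtain ⟨B, hB, hmin⟩ := (finite_isBase M).exists_minimalFor
    (fun B => ∑ e ∈ groundFinset M, w e * indVec B e) _ M.exists_isBase
  have hmin' : ∀ B', M.IsBase B' →
      ∑ e ∈ groundFinset M, w e * indVec B e ≤ ∑ e ∈ groundFinset M, w e * indVec B' e :=
    fun B' hB' => (le_total _ _).elim id fun h => hmin hB' h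
  have key := sum_mul_nonneg_of_lowerPart (S := groundFinset M) (w := w)
    (d := fun e => η e - indVec B e)
    (fun X hX => by
      rw [Finset.sum_sub_distrib, sum_indVec, ncard_inter_eq_rk_of_min_weight hB hmin' hX]
      linarith [h.sum_le X hX.1])
    (by rw [Finset.sum_sub_distrib, h.sum_ground, (isFractionalBase_indVec hB).sum_ground, sub_self])
  simp only [mul_sub, Finset.sum_sub_distrib] at key
  rw [← hf η h.eq_zero, ← hf _ (isFractionalBase_indVec hB).eq_zero] at key
  linarith [hu _ (indVec_mem_basePolytope hB)]

/-! ### Tightness characterizes the universal density -/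

/-- A vector of the base polytope for which all lower level sets are tight. -/
structure IsLevelTight (M : Matroid α) [M.Finite] (η : α → ℝ) : Prop
    extends IsFractionalBase M η where
  tight : ∀ X, IsLowerPart (groundFinset M) η X → ∑ e ∈ X, η e = rk M X

/-- Strict tangent-line inequality for the `p`-th power: for `x > 0` it is Bernoulli's inequality at
`y / x`, rescaled. -/
theorem rpow_add_mul_lt_rpow {p x y : ℝ} (hp : 1 < p) (hx : 0 ≤ x) (hy : 0 ≤ y) (hxy : y ≠ x) :
    x ^ p + p * (x ^ (p - 1) * (y - x)) < y ^ p := by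
  obtain rfl | hx := hx.eq_or_lt
  · rw [Real.zero_rpow (by linarith), Real.zero_rpow (by linarith)]
    simpa using Real.rpow_pos_of_pos (lt_of_le_of_ne hy hxy.symm) p
  · have h := one_add_mul_self_lt_rpow_one_add (s := y / x - 1) (by linarith [div_nonneg hy hx.le])
      (by rw [sub_ne_zero, Ne, div_eq_one_iff_eq hx.ne']; exact hxy) hp
    rw [add_sub_cancel, Real.div_rpow hy hx.le, lt_div_iff₀ (Real.rpow_pos_of_pos hx p)] at h
    have h2 : x ^ p = x ^ (p - 1) * x := by
      rw [← Real.rpow_add_one hx.ne', sub_add_cancel]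
    calc _ = (1 + p * (y / x - 1)) * x ^ p := by rw [h2]; field_simp
      _ < _ := h

theorem rpow_add_mul_le_rpow {p x y : ℝ} (hp : 1 < p) (hx : 0 ≤ x) (hy : 0 ≤ y) :
    x ^ p + p * (x ^ (p - 1) * (y - x)) ≤ y ^ p := by
  by_cases h : y = x
  · simp [h]
  · exact (rpow_add_mul_lt_rpow hp hx hy h).le

theorem pNorm_eq (M : Matroid α) [M.Finite] (p : ℝ) (η : α → ℝ) :
    pNorm M p η = (∑ e ∈ groundFinset M, |η e| ^ p) ^ (1 / p) := by
  rw [pNorm, finsum_mem_eq_finite_toFinset_sum _ M.ground_finite]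
  rfl

theorem IsLevelTight.isUniversalDensity {M : Matroid α} [M.Finite] {η : α → ℝ}
    (h : IsLevelTight M η) : IsUniversalDensity M η := by
  refine ⟨h.mem_basePolytope, fun p hp ζ hζ hne => ?_⟩
  have hζ' := IsFractionalBase.of_mem_basePolytope hζ
  rw [pNorm_eq, pNorm_eq]
  refine Real.rpow_lt_rpow (Finset.sum_nonneg fun e _ => Real.rpow_nonneg (abs_nonneg _) _) ?_
    (by positivity)
  have key := sum_mul_nonneg_of_lowerPart (S := groundFinset M) (w := fun e => η e ^ (p - 1))
    (d := fun e => ζ e - η e)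
    (fun X hX => by
      -- Monotonicity of `x ^ (p - 1)` makes lower level sets of the weight into lower level sets of
      -- `η`, whatever `p` is; this is why one vector serves all `p`.
      rw [Finset.sum_sub_distrib, h.tight X ⟨hX.1, fun e he f hf hf' => ?_⟩]
      · linarith [hζ'.sum_le X hX.1]
      · exact lt_of_not_ge fun hle => (hX.2 e he f hf hf').not_ge
          (Real.rpow_le_rpow (h.nonneg f) hle (by linarith)))
    (by rw [Finset.sum_sub_distrib, h.sum_ground, hζ'.sum_ground, sub_self])
  obtain ⟨e₀, he₀⟩ := Function.ne_iff.1 hne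
  have he₀E : e₀ ∈ M.E := by
    by_contra hE
    exact he₀ (by rw [h.eq_zero _ hE, hζ'.eq_zero _ hE])
  have hlt : ∑ e ∈ groundFinset M, (η e ^ p + p * (η e ^ (p - 1) * (ζ e - η e))) <
      ∑ e ∈ groundFinset M, ζ e ^ p :=
    Finset.sum_lt_sum (fun e _ => rpow_add_mul_le_rpow hp (h.nonneg e) (hζ'.nonneg e))
      ⟨e₀, by simpa using he₀E, rpow_add_mul_lt_rpow hp (h.nonneg _) (hζ'.nonneg _) he₀⟩
  rw [Finset.sum_add_distrib, ← Finset.mul_sum] at hlt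
  have : 0 ≤ p * ∑ e ∈ groundFinset M, η e ^ (p - 1) * (ζ e - η e) :=
    mul_nonneg (by linarith) key
  simp_rw [abs_of_nonneg (h.nonneg _), abs_of_nonneg (hζ'.nonneg _)]
  linarith

/-- `hmin` is the first-order condition for the 2-norm. The `η`-weights of the bases composing `η`
average to `∑ η e * η e`, and none is smaller, so every base with nonzero coefficient has minimum
weight and is tight by greedy exchange. -/
theorem isLevelTight_of_forall_sum_mul_le {M : Matroid α} [M.Finite] {η : α → ℝ}
    (hη : η ∈ basePolytope M)
    (hmin : ∀ B, M.IsBase B →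
      ∑ e ∈ groundFinset M, η e * η e ≤ ∑ e ∈ groundFinset M, η e * indVec B e) :
    IsLevelTight M η := by
  refine ⟨.of_mem_basePolytope hη, fun X hX => ?_⟩
  obtain ⟨ι, _, c, z, hc0, hc1, hz, hsum⟩ := mem_convexHull_iff_exists_fintype.1 hη
  choose B hB hBz using hz
  have hz' : ∀ i e, z i e = indVec (B i) e := fun i e => by rw [← hBz]; rfl
  have hη' : ∀ e, η e = ∑ i, c i * indVec (B i) e := fun e => by
    rw [← hsum]; simp [Finset.sum_apply, hz']
  have hcomb : ∀ (Y : Finset α) (w : α → ℝ),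
      ∑ e ∈ Y, w e * η e = ∑ i, c i * ∑ e ∈ Y, w e * indVec (B i) e := by
    intro Y w
    simp_rw [Finset.mul_sum]
    rw [Finset.sum_comm]
    refine Finset.sum_congr rfl fun e _ => ?_
    rw [hη', Finset.mul_sum]
    exact Finset.sum_congr rfl fun i _ => by ring
  have hzero : ∀ i, c i * (∑ e ∈ groundFinset M, η e * indVec (B i) e -
      ∑ e ∈ groundFinset M, η e * η e) = 0 := by
    have hs : ∑ i, c i * (∑ e ∈ groundFinset M, η e * indVec (B i) e -
        ∑ e ∈ groundFinset M, η e * η e) = 0 := by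
      simp only [mul_sub, Finset.sum_sub_distrib, ← Finset.sum_mul, hc1]
      rw [hcomb _ η]
      ring
    intro i
    exact (Finset.sum_eq_zero_iff_of_nonneg
      fun j _ => mul_nonneg (hc0 j) (sub_nonneg.2 (hmin _ (hB j)))).1 hs i (Finset.mem_univ i)
  have h1 := hcomb X 1
  simp only [Pi.one_apply, one_mul] at h1
  rw [h1]
  have : ∀ i, c i * ∑ e ∈ X, indVec (B i) e = c i * rk M X := by
    intro i
    rcases mul_eq_zero.1 (hzero i) with h0 | h0
    · simp [h0]
    · rw [sum_indVec, ncard_inter_eq_rk_of_min_weight (hB i) (fun B' hB' => ?_) hX]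
      rw [sub_eq_zero.1 h0]
      exact hmin B' hB'
  simp_rw [this, ← Finset.sum_mul, hc1, one_mul]

theorem exists_isLevelTight (M : Matroid α) [M.Finite] : ∃ η, IsLevelTight M η := by
  have hcpt : IsCompact (basePolytope M) :=
    ((finite_isBase M).image _).isCompact_convexHull ℝ
  obtain ⟨B₀, hB₀⟩ := M.exists_isBase
  obtain ⟨η, hη, hmin⟩ := hcpt.exists_isMinOn ⟨_, indVec_mem_basePolytope hB₀⟩
    (f := fun x => ∑ e ∈ groundFinset M, x e * x e) (by fun_prop)
  refine ⟨η, isLevelTight_of_forall_sum_mul_le hη fun B hB => ?_⟩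
  set q := ∑ e ∈ groundFinset M, (indVec B e - η e) * (indVec B e - η e) with hq
  set a := ∑ e ∈ groundFinset M, η e * (indVec B e - η e) with ha
  have hq0 : 0 ≤ q := Finset.sum_nonneg fun e _ => mul_self_nonneg _
  have hstep : ∀ u : ℝ, 0 ≤ u → u ≤ 1 → 0 ≤ u * (2 * a + u * q) := by
    intro u hu0 hu1
    have hmem : (1 - u) • η + u • indVec B ∈ basePolytope M :=
      convex_convexHull ℝ _ hη (indVec_mem_basePolytope hB) (by linarith) hu0 (by ring)
    have h := isMinOn_iff.1 hmin _ hmem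
    have heq : ∑ e ∈ groundFinset M, ((1 - u) • η + u • indVec B) e * ((1 - u) • η + u • indVec B) e
        = ∑ e ∈ groundFinset M, η e * η e + u * (2 * a + u * q) := by
      rw [ha, hq]
      simp only [Finset.mul_sum, mul_add, ← Finset.sum_add_distrib]
      refine Finset.sum_congr rfl fun e _ => ?_
      simp only [Pi.add_apply, Pi.smul_apply, smul_eq_mul]
      ring
    simp only [heq] at h
    linarith
  have ha0 : 0 ≤ a := by
    by_contra! hneg
    have hpos : 0 < q - a := by linarith
    -- If `a < 0`, this `u` lies in `(0, 1]` and satisfies `u * q ≤ -a`, so `2 * a + u * q ≤ a < 0`;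
    -- the denominator is positive even when `q = 0`.
    have h := hstep (-a / (q - a)) (div_nonneg (by linarith) hpos.le)
      ((div_le_one hpos).2 (by linarith))
    have h1 : -a / (q - a) * q ≤ -a := by
      rw [div_mul_eq_mul_div, div_le_iff₀ hpos]
      nlinarith
    have h2 : 0 < -a / (q - a) := div_pos (by linarith) hpos
    nlinarith
  simp only [ha, mul_sub, Finset.sum_sub_distrib] at ha0
  linarith

theorem IsUniversalDensity.eq {M : Matroid α} {η ζ : α → ℝ} (h : IsUniversalDensity M η)
    (h' : IsUniversalDensity M ζ) : η = ζ := by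
  by_contra hne
  exact lt_asymm (h.2 2 one_lt_two ζ h'.1 (Ne.symm hne)) (h'.2 2 one_lt_two η h.1 hne)

theorem isUniversalDensity_iff_isLevelTight {M : Matroid α} [M.Finite] {η : α → ℝ} :
    IsUniversalDensity M η ↔ IsLevelTight M η := by
  refine ⟨fun h => ?_, fun h => h.isUniversalDensity⟩
  obtain ⟨ζ, hζ⟩ := exists_isLevelTight M
  rwa [h.eq hζ.isUniversalDensity]

theorem mul_card_le_sum {S : Finset α} {η : α → ℝ} {a : ℝ} (h : ∀ e ∈ S, a ≤ η e) :
    a * S.card ≤ ∑ e ∈ S, η e := by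
  have := Finset.card_nsmul_le_sum S η a h
  rwa [nsmul_eq_mul, mul_comm] at this

theorem sum_eq_mul_card {S : Finset α} {η : α → ℝ} {a : ℝ} (h : ∀ e ∈ S, η e = a) :
    ∑ e ∈ S, η e = a * S.card := by
  rw [Finset.sum_congr rfl h, Finset.sum_const, nsmul_eq_mul, mul_comm]

/-! ### Principal partition from the level sets -/

/-- The excess of `X` over the minimum of the modular function `η - μ`. -/
theorem sum_sub_eq_sum_min_add {S X : Finset α} (hX : X ⊆ S) (η : α → ℝ) (μ : ℝ) :
    ∑ e ∈ X, (η e - μ) = ∑ e ∈ S, min (η e - μ) 0 +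
      ∑ e ∈ S, if e ∈ X then max (η e - μ) 0 else max (μ - η e) 0 := by
  rw [← Finset.sum_add_distrib, ← Finset.inter_eq_right.2 hX, ← Finset.sum_ite_mem]
  refine Finset.sum_congr rfl fun e he => ?_
  simp only [Finset.mem_inter, he, true_and]
  split_ifs
  · rw [min_add_max, add_zero]
  · rcases le_total (η e) μ with h | h
    · rw [min_eq_left (by linarith), max_eq_left (by linarith)]
      ring
    · rw [min_eq_right (by linarith), max_eq_right (by linarith)]
      ring

theorem rk_sub_mul_ncard_ge {M : Matroid α} [M.Finite] {η : α → ℝ} (h : IsLevelTight M η) (μ : ℝ)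
    {X : Finset α} (hX : X ⊆ groundFinset M) :
    ∑ e ∈ X, (η e - μ) ≤ (rk M X : ℝ) - μ * (X : Set α).ncard := by
  rw [Finset.sum_sub_distrib, Finset.sum_const, nsmul_eq_mul, ncard_coe_finset]
  linarith [h.sum_le X hX]

theorem mem_minimizers_of_lowerPart {M : Matroid α} [M.Finite] {η : α → ℝ} (h : IsLevelTight M η)
    {μ : ℝ} {X : Finset α} (hX : IsLowerPart (groundFinset M) η X) (hle : ∀ e ∈ X, η e ≤ μ)
    (hge : ∀ e ∈ groundFinset M, e ∉ X → μ ≤ η e) : (X : Set α) ∈ minimizers M μ := by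
  refine ⟨coe_subset_ground hX.1, fun Y hY => ?_⟩
  lift Y to Finset α using M.ground_finite.subset hY
  have hYS : Y ⊆ groundFinset M := fun e he => by simpa using hY he
  have h1 : (rk M X : ℝ) - μ * (X : Set α).ncard = ∑ e ∈ X, (η e - μ) := by
    rw [Finset.sum_sub_distrib, Finset.sum_const, nsmul_eq_mul, ncard_coe_finset, h.tight X hX,
      mul_comm]
  refine le_trans ?_ (rk_sub_mul_ncard_ge h μ hYS)
  rw [h1, sum_sub_eq_sum_min_add hX.1, sum_sub_eq_sum_min_add hYS]
  gcongr with e he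
  have : (if e ∈ X then max (η e - μ) 0 else max (μ - η e) 0) = 0 := by
    split_ifs with heX
    · exact max_eq_right (by linarith [hle e heX])
    · exact max_eq_right (by linarith [hge e he heX])
  rw [this]
  split_ifs <;> exact le_max_right _ _

/-- The level set `η < μ` attains the minimum of the modular lower bound, so a minimizer has zero
excess over it. The excess is a sum of nonnegative terms, each of which must vanish. -/
theorem of_mem_minimizers {M : Matroid α} [M.Finite] {η : α → ℝ} (h : IsLevelTight M η)
    {μ : ℝ} {Y : Set α} (hY : Y ∈ minimizers M μ) :
    (∀ e ∈ Y, η e ≤ μ) ∧ ∀ e ∈ M.E, η e < μ → e ∈ Y := by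
  obtain ⟨hYE, hmin⟩ := hY
  lift Y to Finset α using M.ground_finite.subset hYE
  have hYS : Y ⊆ groundFinset M := fun e he => by simpa using hYE he
  have hA := isLowerPart_filter_lt (groundFinset M) η μ
  have h1 := (rk_sub_mul_ncard_ge h μ hYS).trans (hmin _ (coe_subset_ground hA.1))
  have h2 : (rk M ((groundFinset M).filter (fun e => η e < μ) : Finset α) : ℝ) -
      μ * ((groundFinset M).filter (fun e => η e < μ) : Set α).ncard =
      ∑ e ∈ groundFinset M with η e < μ, (η e - μ) := by
    rw [Finset.sum_sub_distrib, Finset.sum_const, nsmul_eq_mul, ncard_coe_finset, h.tight _ hA,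
      mul_comm]
  rw [h2, sum_sub_eq_sum_min_add hYS, sum_sub_eq_sum_min_add hA.1] at h1
  have h3 : ∑ e ∈ groundFinset M, (if e ∈ (groundFinset M).filter (fun e => η e < μ) then
      max (η e - μ) 0 else max (μ - η e) 0) = 0 := by
    refine Finset.sum_eq_zero fun e he => ?_
    simp only [Finset.mem_filter, he, true_and]
    split_ifs with hlt
    · exact max_eq_right (by linarith)
    · exact max_eq_right (by linarith)
  rw [h3] at h1
  have hnn : ∀ e ∈ groundFinset M, 0 ≤ if e ∈ Y then max (η e - μ) 0 else max (μ - η e) 0 :=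
    fun e _ => by split_ifs <;> exact le_max_right _ _
  have h4 := (Finset.sum_eq_zero_iff_of_nonneg hnn).1
    (le_antisymm (by linarith) (Finset.sum_nonneg hnn))
  constructor
  · intro e he
    have h5 := h4 e (hYS he)
    rw [if_pos (by exact_mod_cast he)] at h5
    linarith [le_max_left (η e - μ) 0]
  · intro e he hlt
    by_contra heY
    have h5 := h4 e (by simpa using he)
    rw [if_neg (by exact_mod_cast heY)] at h5
    linarith [le_max_left (μ - η e) 0]

theorem sUnion_minimizers {M : Matroid α} [M.Finite] {η : α → ℝ} (h : IsLevelTight M η) (μ : ℝ) :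
    ⋃₀ minimizers M μ = {e ∈ M.E | η e ≤ μ} := by
  ext e
  constructor
  · rintro ⟨Y, hY, he⟩
    exact ⟨hY.1 he, (of_mem_minimizers h hY).1 e he⟩
  · intro he
    refine ⟨_, mem_minimizers_of_lowerPart h (isLowerPart_filter_le (groundFinset M) η μ) ?_ ?_, ?_⟩
    · intro f hf
      exact (Finset.mem_filter.1 hf).2
    · intro f hf hf'
      simp only [Finset.mem_filter, hf, true_and, not_le] at hf'
      exact hf'.le
    · simpa using he

theorem sInter_minimizers {M : Matroid α} [M.Finite] {η : α → ℝ} (h : IsLevelTight M η) (μ : ℝ) :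
    ⋂₀ minimizers M μ = {e ∈ M.E | η e < μ} := by
  ext e
  constructor
  · intro he
    have := he _ (mem_minimizers_of_lowerPart h (μ := μ)
      (isLowerPart_filter_lt (groundFinset M) η μ) ?_ ?_)
    · simpa using this
    · intro f hf
      exact (Finset.mem_filter.1 hf).2.le
    · intro f hf hf'
      simpa [Finset.mem_filter, mem_groundFinset.1 hf] using hf'
  · rintro ⟨he, hlt⟩ Y hY
    exact (of_mem_minimizers h hY).2 e he hlt

theorem principalPartition_eq {M : Matroid α} [M.Finite] {η : α → ℝ} (h : IsLevelTight M η) :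
    principalPartition M = {P | P.Nonempty ∧ ∃ μ : ℝ, P = {e ∈ M.E | η e = μ}} := by
  have : ∀ μ, ⋃₀ minimizers M μ \ ⋂₀ minimizers M μ = {e ∈ M.E | η e = μ} := by
    intro μ
    rw [sUnion_minimizers h, sInter_minimizers h]
    ext e
    simp only [mem_sdiff, mem_ofPred_eq, not_and, not_lt]
    exact ⟨fun ⟨⟨he, h1⟩, h2⟩ => ⟨he, le_antisymm h1 (h2 he)⟩,
      fun ⟨he, h1⟩ => ⟨⟨he, h1.le⟩, fun _ => h1.ge⟩⟩
  simp only [principalPartition, this]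

/-! ### Truncation, balancity and contraction -/

@[simp] theorem groundFinset_truncation (M : Matroid α) [M.Finite] (t : ℕ) :
    groundFinset (truncation M t) = groundFinset M := by
  ext; simp

/-- Capping the universal density yields the universal density of a truncation. -/
theorem IsLevelTight.truncation {M : Matroid α} [M.Finite] {η : α → ℝ} (h : IsLevelTight M η)
    {v : ℝ} {t : ℕ} (hv : 0 ≤ v) (ht : ∑ e ∈ groundFinset M, min (η e) v = t) :
    IsLevelTight (truncation M t) (fun e => min (η e) v) := by
  have hnn : ∀ e, 0 ≤ min (η e) v := fun e => le_min (h.nonneg e) hv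
  have hle : ∀ X ⊆ groundFinset M, ∑ e ∈ X, min (η e) v ≤ t := fun X hX =>
    (Finset.sum_le_sum_of_subset_of_nonneg hX fun e _ _ => hnn e).trans ht.le
  have hle' : ∀ X ⊆ groundFinset M, ∑ e ∈ X, min (η e) v ≤ rk M X := fun X hX =>
    (Finset.sum_le_sum fun e _ => min_le_left _ _).trans (h.sum_le X hX)
  have htr : t ≤ rk M M.E := by
    have := hle' _ subset_rfl
    rw [ht, coe_groundFinset] at this
    exact_mod_cast this
  have hground : ∑ e ∈ groundFinset (BaseModulus.truncation M t), min (η e) v =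
      rk (BaseModulus.truncation M t) M.E := by
    rw [groundFinset_truncation, ht, rk_truncation, min_eq_right htr]
  refine ⟨⟨fun e he => ?_, fun X hX => ?_, hground⟩, fun X hX => ?_⟩
  · rw [h.eq_zero e he, min_eq_left hv]
  · rw [groundFinset_truncation] at hX
    rw [rk_truncation, Nat.cast_min]
    exact le_min (hle' X hX) (hle X hX)
  · by_cases hXS : X = groundFinset (BaseModulus.truncation M t)
    · rw [hXS, hground, coe_groundFinset, truncation_ground]
    · rw [groundFinset_truncation] at hX hXS
      -- A proper lower part of the capped vector lies strictly below the cap, so capping is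
      -- invisible on it and it is a lower part of `η`.
      obtain ⟨f, hf, hfX⟩ := Finset.exists_of_ssubset (hX.1.ssubset_of_ne hXS)
      have hlt : ∀ e ∈ X, η e < v := fun e he => by
        have := hX.2 e he f hf hfX
        simpa using this.trans_le (min_le_right _ _)
      have hsum : ∑ e ∈ X, min (η e) v = rk M X := by
        rw [← h.tight X ⟨hX.1, fun e he g hg hg' => ?_⟩]
        · exact Finset.sum_congr rfl fun e he => min_eq_left (hlt e he).le
        · have : min (η e) v < min (η g) v := hX.2 e he g hg hg'
          rw [min_eq_left (hlt e he).le] at this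
          exact this.trans_le (min_le_left _ _)
      have hXt : rk M X ≤ t := by
        have := hle X hX.1
        rw [hsum] at this
        exact_mod_cast this
      rw [hsum, rk_truncation, min_eq_left hXt]

/-- The lowest level `X` of `η` has `r(X) = s|X|`, so a constant density `a` must satisfy `a ≤ s`.
Conversely, a cap at `t / |E| ≤ s` flattens `η` completely. -/
theorem isHomogeneous_truncation_iff {M : Matroid α} [M.Finite] {η : α → ℝ}
    (h : IsLevelTight M η) {s : ℝ} (hs : ∀ e ∈ M.E, s ≤ η e) (hs' : ∃ e ∈ M.E, η e = s)
    {t : ℕ} (ht : t ≤ rk M M.E) :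
    IsHomogeneous (truncation M t) ↔ (t : ℝ) ≤ (M.E.ncard : ℝ) * s := by
  obtain ⟨e₀, he₀, hes⟩ := hs'
  have hcard : M.E.ncard = (groundFinset M).card := by
    rw [← coe_groundFinset, ncard_coe_finset]
  have hn : (0 : ℝ) < (groundFinset M).card := by
    exact_mod_cast Finset.card_pos.2 ⟨e₀, by simpa using he₀⟩
  rw [hcard]
  constructor
  · rintro ⟨ζ, hζ, a, ha⟩
    have hζ' := IsFractionalBase.of_mem_basePolytope hζ.1
    have h1 := hζ'.sum_ground
    rw [sum_eq_mul_card (a := a) (fun e he => ha e (mem_groundFinset.1 he)),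
      groundFinset_truncation, truncation_ground, rk_truncation, min_eq_right ht] at h1
    set X := (groundFinset M).filter (fun e => η e ≤ s) with hX
    have hXl : IsLowerPart (groundFinset M) η X := isLowerPart_filter_le _ _ _
    have h2 := hζ'.sum_le X (by rw [groundFinset_truncation]; exact hXl.1)
    rw [sum_eq_mul_card (a := a) (fun e he => ha e (coe_subset_ground hXl.1 he)),
      rk_truncation, Nat.cast_min] at h2
    have h3 := h.tight X hXl
    rw [sum_eq_mul_card (a := s) (fun e he => le_antisymm (Finset.mem_filter.1 he).2
      (hs e (coe_subset_ground hXl.1 he)))] at h3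
    have hXn : (0 : ℝ) < X.card := by
      exact_mod_cast Finset.card_pos.2 ⟨e₀, by simp [hX, he₀, hes]⟩
    have h4 : a ≤ s := by
      rw [← h3] at h2
      exact le_of_mul_le_mul_right (h2.trans (min_le_left _ _)) hXn
    rw [← h1, mul_comm]
    exact mul_le_mul_of_nonneg_left h4 hn.le
  · intro hle
    have hv : (t : ℝ) / (groundFinset M).card ≤ s := by
      rw [div_le_iff₀ hn]
      linarith
    have hmin : ∀ e ∈ groundFinset M,
        min (η e) ((t : ℝ) / (groundFinset M).card) = (t : ℝ) / (groundFinset M).card :=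
      fun e he => min_eq_right (hv.trans (hs e (mem_groundFinset.1 he)))
    refine ⟨_, (h.truncation (v := (t : ℝ) / (groundFinset M).card) (by positivity)
      ?_).isUniversalDensity, _, fun e he => hmin e (mem_groundFinset.2 he)⟩
    rw [sum_eq_mul_card hmin, div_mul_cancel₀ _ hn.ne']

theorem isBalancity_floor {M : Matroid α} [M.Finite] {η : α → ℝ}
    (h : IsLevelTight M η) {s : ℝ} (hs : ∀ e ∈ M.E, s ≤ η e) (hs' : ∃ e ∈ M.E, η e = s)
    (hpos : 0 < s) : IsBalancity M ⌊(M.E.ncard : ℝ) * s⌋₊ := by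
  have hcard : M.E.ncard = (groundFinset M).card := by
    rw [← coe_groundFinset, ncard_coe_finset]
  have hfl := Nat.floor_le (a := (M.E.ncard : ℝ) * s) (by positivity)
  have hrk : ⌊(M.E.ncard : ℝ) * s⌋₊ ≤ rk M M.E := by
    have h1 := mul_card_le_sum (S := groundFinset M) (fun e he => hs e (mem_groundFinset.1 he))
    rw [h.sum_ground, ← hcard, mul_comm] at h1
    exact_mod_cast hfl.trans h1
  refine ⟨⟨?_, hrk, (isHomogeneous_truncation_iff h hs hs' hrk).2 hfl⟩, fun t ht => ?_⟩
  -- The lowest level set has rank `s|X| > 0`; being an integer, it is at least 1, hence so is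
  -- `s|E|`.
  · set X := (groundFinset M).filter (fun e => η e ≤ s) with hX
    have hXl : IsLowerPart (groundFinset M) η X := isLowerPart_filter_le _ _ _
    have h3 := h.tight X hXl
    rw [sum_eq_mul_card (a := s) (fun e he => le_antisymm (Finset.mem_filter.1 he).2
      (hs e (coe_subset_ground hXl.1 he)))] at h3
    obtain ⟨e₀, he₀, hes⟩ := hs'
    have hXn : (0 : ℝ) < X.card := by
      exact_mod_cast Finset.card_pos.2 ⟨e₀, by simp [hX, he₀, hes]⟩
    have h4 : (0 : ℝ) < rk M X := by
      rw [← h3]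
      positivity
    have h5 : (1 : ℝ) ≤ rk M X := by exact_mod_cast (Nat.cast_pos.1 h4)
    refine Nat.le_floor ?_
    have h6 : (X.card : ℝ) ≤ M.E.ncard := by
      rw [hcard]
      exact_mod_cast Finset.card_le_card hXl.1
    rw [Nat.cast_one]
    nlinarith
  · exact Nat.le_floor ((isHomogeneous_truncation_iff h hs hs' ht.2.1).1 ht.2.2)

/-- Both the rank and the `η`-sum of `X ∪ F` drop by `r(F)`, because `F` is tight; and a lower part
of the contracted vector becomes a lower part of `η` once `F` is added. -/
theorem IsLevelTight.contract {M : Matroid α} [M.Finite] {η : α → ℝ} (h : IsLevelTight M η)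
    {F : Finset α} (hF : IsLowerPart (groundFinset M) η F) :
    IsLevelTight (M.contract F) (fun e => if e ∈ F then 0 else η e) := by
  have hmem : ∀ {e}, e ∈ groundFinset (M.contract F) ↔ e ∈ groundFinset M ∧ e ∉ F := by simp
  have hdisj : ∀ X ⊆ groundFinset (M.contract F), Disjoint X F := fun X hX =>
    Finset.disjoint_left.2 fun e he => (hmem.1 (hX he)).2
  have hsum : ∀ X ⊆ groundFinset (M.contract F),
      ∑ e ∈ X, (if e ∈ F then 0 else η e) = ∑ e ∈ X ∪ F, η e - rk M F := by
    intro X hX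
    rw [Finset.sum_union (hdisj X hX), h.tight F hF, add_sub_cancel_right]
    exact Finset.sum_congr rfl fun e he => if_neg (hmem.1 (hX he)).2
  have hrk : ∀ X ⊆ groundFinset (M.contract F),
      (rk (M.contract F) X : ℝ) = rk M (X ∪ F : Finset α) - rk M F := by
    intro X hX
    rw [Finset.coe_union, ← rk_contract_add M (coe_subset_ground hF.1) (coe_subset_ground hX)]
    push_cast
    ring
  have hsub : ∀ X ⊆ groundFinset (M.contract F), X ∪ F ⊆ groundFinset M := fun X hX =>
    Finset.union_subset (fun e he => (hmem.1 (hX he)).1) hF.1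
  have htight : ∀ X, IsLowerPart (groundFinset (M.contract F)) (fun e => if e ∈ F then 0 else η e) X
      → ∑ e ∈ X, (if e ∈ F then 0 else η e) = rk (M.contract F) X := by
    intro X hX
    rw [hsum X hX.1, hrk X hX.1, h.tight _ ⟨hsub X hX.1, fun e he f hf hf' => ?_⟩]
    rw [Finset.mem_union, not_or] at hf'
    by_cases heF : e ∈ F
    · exact hF.2 e heF f hf hf'.2
    · have := hX.2 e ((Finset.mem_union.1 he).resolve_right heF) f (hmem.2 ⟨hf, hf'.2⟩) hf'.1
      simpa [heF, hf'.2] using this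
  refine ⟨⟨fun e he => ?_, fun X hX => ?_, ?_⟩, htight⟩
  · split_ifs with heF
    · rfl
    · exact h.eq_zero e fun heE => he ⟨heE, heF⟩
  · rw [hsum X hX, hrk X hX]
    linarith [h.sum_le _ (hsub X hX)]
  · rw [htight _ (isLowerPart_self _ _), coe_groundFinset]

/-- Otherwise the level set `η ≤ 0` would have rank at most 0 by tightness while containing a
nonloop. -/
theorem IsLevelTight.pos {M : Matroid α} [M.Finite] [M.Loopless] {η : α → ℝ}
    (h : IsLevelTight M η) {e : α} (he : e ∈ M.E) : 0 < η e := by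
  by_contra! hle
  have hX : IsLowerPart (groundFinset M) η ((groundFinset M).filter (fun e => η e ≤ 0)) :=
    isLowerPart_filter_le _ _ _
  have h1 := h.tight _ hX
  have h2 : ∑ e ∈ groundFinset M with η e ≤ 0, η e ≤ 0 :=
    Finset.sum_nonpos fun e he => (Finset.mem_filter.1 he).2
  have h3 : 1 ≤ rk M ((groundFinset M).filter (fun e => η e ≤ 0) : Finset α) := by
    have := ncard_le_rk (M := M) (I := {e})
      (X := ((groundFinset M).filter (fun e => η e ≤ 0) : Finset α))
      (Matroid.indep_singleton.2 (M.isNonloop_of_loopless he)) (by simp [he, hle])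
    rwa [ncard_singleton] at this
  rw [h1] at h2
  have : (1 : ℝ) ≤ rk M ((groundFinset M).filter (fun e => η e ≤ 0) : Finset α) := by
    exact_mod_cast h3
  linarith

/-! ### Sums and ranks across consecutive levels -/

theorem sum_filter_lt_add_sum_filter_ge (S : Finset α) (η f : α → ℝ) (a : ℝ) :
    ∑ e ∈ S with η e < a, f e + ∑ e ∈ S with a ≤ η e, f e = ∑ e ∈ S, f e := by
  rw [← Finset.sum_filter_add_sum_filter_not S (fun e => η e < a) f]
  simp only [not_lt]

/-- The gap leaves no values strictly between `a` and `b`, and `p` is the size of the level `η = a`.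
-/
theorem exists_rk_filter_lt_succ {M : Matroid α} [M.Finite] {η : α → ℝ} (h : IsLevelTight M η)
    {a b : ℝ} (hab : a < b) (hgap : ∀ e ∈ M.E, η e ≤ a ∨ b ≤ η e) (hwit : ∃ e ∈ M.E, η e = a) :
    ∃ p : ℕ, 0 < p ∧
      ((groundFinset M).filter (fun e => a ≤ η e)).card =
        p + ((groundFinset M).filter (fun e => b ≤ η e)).card ∧
      (rk M ((groundFinset M).filter (fun e => η e < b) : Finset α) : ℝ) =
        rk M ((groundFinset M).filter (fun e => η e < a) : Finset α) + a * p := by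
  set P := (groundFinset M).filter (fun e => η e = a) with hP
  obtain ⟨e₀, he₀, hea⟩ := hwit
  have h1 : (groundFinset M).filter (fun e => a ≤ η e) =
      P ∪ (groundFinset M).filter (fun e => b ≤ η e) := by
    ext e
    simp only [hP, Finset.mem_filter, Finset.mem_union, mem_groundFinset]
    constructor
    · rintro ⟨he, hle⟩
      exact (hgap e he).imp (fun h' => ⟨he, le_antisymm h' hle⟩) (fun h' => ⟨he, h'⟩)
    · rintro (⟨he, h'⟩ | ⟨he, h'⟩)
      · exact ⟨he, h'.ge⟩
      · exact ⟨he, by linarith⟩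
  have h2 : (groundFinset M).filter (fun e => η e < b) =
      (groundFinset M).filter (fun e => η e < a) ∪ P := by
    ext e
    simp only [hP, Finset.mem_filter, Finset.mem_union, mem_groundFinset]
    constructor
    · rintro ⟨he, hlt⟩
      rcases ((hgap e he).resolve_right hlt.not_ge).lt_or_eq with h' | h'
      · exact .inl ⟨he, h'⟩
      · exact .inr ⟨he, h'⟩
    · rintro (⟨he, h'⟩ | ⟨he, h'⟩)
      · exact ⟨he, by linarith⟩
      · exact ⟨he, by linarith⟩
  refine ⟨P.card, Finset.card_pos.2 ⟨e₀, by simp [hP, he₀, hea]⟩, ?_, ?_⟩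
  · rw [h1, Finset.card_union_of_disjoint]
    refine Finset.disjoint_left.2 fun e he he' => ?_
    simp only [hP, Finset.mem_filter] at he he'
    linarith [he.2, he'.2]
  · rw [← h.tight _ (isLowerPart_filter_lt _ _ _), ← h.tight _ (isLowerPart_filter_lt _ _ _), h2,
      Finset.sum_union, sum_eq_mul_card (S := P) (fun e he => (Finset.mem_filter.1 he).2)]
    refine Finset.disjoint_left.2 fun e he he' => ?_
    simp only [hP, Finset.mem_filter] at he he'
    linarith [he.2, he'.2]

theorem sum_min_eq {M : Matroid α} [M.Finite] {η : α → ℝ} (h : IsLevelTight M η)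
    {a v : ℝ} (hva : v ≤ a) (hlt : ∀ e ∈ M.E, η e < a → η e < v) :
    ∑ e ∈ groundFinset M, min (η e) v =
      rk M ((groundFinset M).filter (fun e => η e < a) : Finset α) +
        v * ((groundFinset M).filter (fun e => a ≤ η e)).card := by
  rw [← sum_filter_lt_add_sum_filter_ge _ η _ a, ← h.tight _ (isLowerPart_filter_lt _ _ _)]
  congr 1
  · refine Finset.sum_congr rfl fun e he => min_eq_left ?_
    rw [Finset.mem_filter, mem_groundFinset] at he
    exact (hlt e he.1 he.2).le
  · exact sum_eq_mul_card fun e he => min_eq_right (hva.trans (Finset.mem_filter.1 he).2)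

end BaseModulus

/-! ### The main theorem -/

theorem theorem3p4 {α : Type*} (M : Matroid α) [M.Finite] [M.Loopless] [M.RankPos] :
    (∃ η : α → ℝ, IsUniversalDensity M η) ∧
    ∀ η : α → ℝ, IsUniversalDensity M η →
    -- `s 1 < ⋯ < s k` are the distinct values of the universal density on the ground set
    ∀ (k : ℕ) (s : ℕ → ℝ), StrictMonoOn s (Set.Icc 1 k) → s '' Set.Icc 1 k = η '' M.E →
    ∀ E : ℕ → Set α, (∀ i ∈ Set.Icc 1 k, E i = {e ∈ M.E | s i ≤ η e}) →
    ∀ b c : ℕ → ℕ, (∀ i ∈ Set.Icc 1 k, b i = ⌊((E i).ncard : ℝ) * s i⌋₊) →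
      c 0 = 0 → (∀ i ∈ Set.Icc 1 k, c i = ⌊((E i).ncard : ℝ) * s i⌋₊ + rk M (M.E \ E i)) →
    -- the balancities of the contractions
    (∀ i ∈ Set.Icc 1 k, IsBalancity (M.contract (M.E \ E i)) (b i)) ∧
    -- the chain `0 = c 0 < c 1 ≤ ⋯ ≤ c (k - 1) < c k = r(M)`
    (1 ≤ k ∧ 0 < c 1 ∧ (∀ i, 1 ≤ i → i + 1 ≤ k → c i ≤ c (i + 1)) ∧
      c (k - 1) < c k ∧ c k = rk M M.E) ∧
    -- `c i - b i = r(E - E i) ≤ c (i - 1)`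
    (∀ i ∈ Set.Icc 1 k,
      (c i : ℤ) - (b i : ℤ) = (rk M (M.E \ E i) : ℤ) ∧ rk M (M.E \ E i) ≤ c (i - 1)) ∧
    -- the universal density and the principal partition of every truncation
    (∀ i ∈ Set.Icc 1 k, ∀ t : ℕ, c (i - 1) < t → t ≤ c i →
      (∃ ηt : α → ℝ, IsUniversalDensity (truncation M t) ηt ∧
        (∀ e ∈ E i, ηt e = ((t : ℝ) - (rk M (M.E \ E i) : ℝ)) / ((E i).ncard : ℝ)) ∧
        (∀ e ∈ M.E \ E i, ηt e = η e)) ∧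
      principalPartition (truncation M t) =
        insert (E i) ((fun j => {e ∈ M.E | η e = s j}) '' Set.Ico 1 i)) := by
  classical
  refine ⟨(exists_isLevelTight M).imp fun η h => h.isUniversalDensity, ?_⟩
  intro η hη k s hs himg E hE b c hb hc0 hc
  have h := isUniversalDensity_iff_isLevelTight.1 hη
  have hval : ∀ e ∈ M.E, ∃ j ∈ Set.Icc 1 k, s j = η e := fun e he => by
    have : η e ∈ s '' Set.Icc 1 k := himg ▸ mem_image_of_mem η he
    exact this
  have hwit : ∀ i ∈ Set.Icc 1 k, ∃ e ∈ M.E, η e = s i := fun i hi => by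
    have : s i ∈ η '' M.E := himg ▸ mem_image_of_mem s hi
    exact this
  have hspos : ∀ i ∈ Set.Icc 1 k, 0 < s i := fun i hi => by
    obtain ⟨e, he, heq⟩ := hwit i hi
    exact heq ▸ h.pos he
  set n : ℕ → ℕ := fun i => ((groundFinset M).filter (fun e => s i ≤ η e)).card with hn
  set r : ℕ → ℕ := fun i => rk M ((groundFinset M).filter (fun e => η e < s i) : Finset α) with hr
  have hdiff : ∀ i ∈ Set.Icc 1 k,
      M.E \ E i = ((groundFinset M).filter (fun e => η e < s i) : Finset α) := fun i hi => by
    ext e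
    simp only [hE i hi, mem_sdiff, mem_ofPred_eq, not_and, not_le, Finset.coe_filter,
      mem_groundFinset]
    exact ⟨fun he => ⟨he.1, he.2 he.1⟩, fun he => ⟨he.1, fun _ => he.2⟩⟩
  have hrE : ∀ i ∈ Set.Icc 1 k, rk M (M.E \ E i) = r i := fun i hi => by rw [hdiff i hi]
  have hnE : ∀ i ∈ Set.Icc 1 k, (E i).ncard = n i := fun i hi => by
    have : E i = ((groundFinset M).filter (fun e => s i ≤ η e) : Finset α) := by
      ext e
      simp [hE i hi]
    rw [this, ncard_coe_finset]
  have hnpos : ∀ i ∈ Set.Icc 1 k, (0 : ℝ) < n i := fun i hi => by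
    obtain ⟨e, he, heq⟩ := hwit i hi
    exact_mod_cast Finset.card_pos.2 ⟨e, by simp [he, heq]⟩
  -- Both sides are the total of `η` capped at `s i`: the level `η = s i` may be counted with the
  -- capped or with the uncapped elements.
  have hstep : ∀ i, 1 ≤ i → i + 1 ≤ k →
      (n i : ℝ) * s i + r i = n (i + 1) * s i + r (i + 1) := by
    intro i hi hik
    have hi' : i ∈ Set.Icc 1 k := ⟨hi, by omega⟩
    have hi'' : i + 1 ∈ Set.Icc 1 k := ⟨by omega, hik⟩
    obtain ⟨p, -, h1, h2⟩ := exists_rk_filter_lt_succ h (hs hi' hi'' (Nat.lt_succ_self i))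
      (fun e he => by
        obtain ⟨j, hj, hje⟩ := hval e he
        rw [← hje, hs.le_iff_le hj hi', hs.le_iff_le hi'' hj]
        omega) (hwit i hi')
    have h3 : n i = p + n (i + 1) := h1
    have h4 : (r (i + 1) : ℝ) = r i + s i * p := h2
    rw [h3, h4]
    push_cast
    ring
  have hcr : ∀ i ∈ Set.Icc 1 k, c i = ⌊(n i : ℝ) * s i⌋₊ + r i := fun i hi => by
    rw [hc i hi, hrE i hi, hnE i hi]
  have hcle : ∀ i ∈ Set.Icc 1 k, (c i : ℝ) ≤ n i * s i + r i := fun i hi => by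
    rw [hcr i hi, Nat.cast_add]
    gcongr
    exact Nat.floor_le (mul_nonneg (hnpos i hi).le (hspos i hi).le)
  have hclt : ∀ i ∈ Set.Icc 1 k, (n i : ℝ) * s i + r i < c i + 1 := fun i hi => by
    rw [hcr i hi, Nat.cast_add]
    linarith [Nat.lt_floor_add_one ((n i : ℝ) * s i)]
  have hk : 1 ≤ k := by
    obtain ⟨e, he⟩ := M.ground_nonempty
    obtain ⟨j, hj, -⟩ := hval e he
    exact hj.1.trans hj.2
  have hkk : k ∈ Set.Icc 1 k := ⟨hk, le_rfl⟩
  have h1k : 1 ∈ Set.Icc 1 k := ⟨le_rfl, hk⟩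
  have hr1 : r 1 = 0 := by
    have : (groundFinset M).filter (fun e => η e < s 1) = ∅ := by
      refine Finset.filter_false_of_mem fun e he => ?_
      obtain ⟨j, hj, hje⟩ := hval e (mem_groundFinset.1 he)
      rw [← hje, not_lt, hs.le_iff_le h1k hj]
      exact hj.1
    simp only [hr, this, Finset.coe_empty, rk_empty]
  have htop : (n k : ℝ) * s k + r k = rk M M.E := by
    rw [← h.sum_ground, ← sum_filter_lt_add_sum_filter_ge _ η η (s k),
      h.tight _ (isLowerPart_filter_lt _ _ _), sum_eq_mul_card (a := s k), mul_comm, add_comm]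
    intro e he
    rw [Finset.mem_filter, mem_groundFinset] at he
    obtain ⟨j, hj, hje⟩ := hval e he.1
    refine le_antisymm ?_ he.2
    rw [← hje, hs.le_iff_le hj hkk]
    exact hj.2
  have hbal : ∀ i ∈ Set.Icc 1 k, IsBalancity (M.contract (M.E \ E i)) (b i) := by
    intro i hi
    have hF := isLowerPart_filter_lt (groundFinset M) η (s i)
    have hground : (M.contract (M.E \ E i)).E = E i := by
      rw [Matroid.contract_ground, sdiff_sdiff_cancel_left]
      rw [hE i hi]
      exact fun e he => he.1
    have hcard : b i = ⌊((M.contract (M.E \ E i)).E.ncard : ℝ) * s i⌋₊ := by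
      rw [hground, hb i hi]
    rw [hcard, hdiff i hi]
    refine isBalancity_floor (h.contract hF) ?_ ?_ (hspos i hi)
    · rintro e ⟨heE : e ∈ M.E, he⟩
      rw [Finset.mem_coe] at he
      simp only [he, if_false]
      exact le_of_not_gt fun hlt => he (Finset.mem_filter.2 ⟨mem_groundFinset.2 heE, hlt⟩)
    · obtain ⟨e, he, hes⟩ := hwit i hi
      have heF : e ∉ (groundFinset M).filter (fun e => η e < s i) := by simp [hes]
      exact ⟨e, ⟨he, heF⟩, by simp only [heF, if_false, hes]⟩
  -- At the top level the floor loses nothing, since `n k * s k + r k` is already the integer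
  -- `r(M)`.
  have hck : c k = rk M M.E := by
    have h1 := hcle k hkk
    have h2 := hclt k hkk
    rw [htop] at h1 h2
    have h1' : c k ≤ rk M M.E := by exact_mod_cast h1
    have h2' : rk M M.E < c k + 1 := by exact_mod_cast h2
    omega
  have hrc : ∀ i ∈ Set.Icc 1 k, r i ≤ c (i - 1) := by
    intro i hi
    obtain rfl | hi1 := hi.1.eq_or_lt
    · rw [hr1]
      exact Nat.zero_le _
    · obtain ⟨j, rfl⟩ : ∃ j, i = j + 1 := ⟨i - 1, by omega⟩
      have hj : j ∈ Set.Icc 1 k := ⟨by omega, by have := hi.2; omega⟩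
      have h1 := hclt j hj
      rw [hstep j hj.1 hi.2] at h1
      have h2 := mul_nonneg (hnpos _ hi).le (hspos j hj).le
      have h3 : (r (j + 1) : ℝ) < c j + 1 := by linarith
      have h4 : r (j + 1) < c j + 1 := by exact_mod_cast h3
      rw [Nat.add_sub_cancel]
      omega
  refine ⟨hbal, ⟨hk, ?_, ?_, ?_, hck⟩, ?_, ?_⟩
  · have h1 := (hbal 1 h1k).1.1
    rw [hc 1 h1k, ← hb 1 h1k]
    omega
  · intro i hi hik
    have hi' : i ∈ Set.Icc 1 k := ⟨hi, by omega⟩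
    have hi'' : i + 1 ∈ Set.Icc 1 k := ⟨by omega, hik⟩
    have h1 := hcle i hi'
    rw [hstep i hi hik] at h1
    have h2 := hclt _ hi''
    have h3 := mul_le_mul_of_nonneg_left (hs hi' hi'' (Nat.lt_succ_self i)).le (hnpos _ hi'').le
    have h4 : (c i : ℝ) < c (i + 1) + 1 := by linarith
    have h5 : c i < c (i + 1) + 1 := by exact_mod_cast h4
    omega
  · obtain rfl | hk1 := hk.eq_or_lt
    · have h1 := (hbal 1 h1k).1.1
      rw [Nat.sub_self, hc0, hc 1 h1k, ← hb 1 h1k]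
      omega
    · obtain ⟨j, rfl⟩ : ∃ j, k = j + 1 := ⟨k - 1, by omega⟩
      have hj : j ∈ Set.Icc 1 (j + 1) := ⟨by omega, by omega⟩
      have h1 := hcle j hj
      rw [hstep j hj.1 le_rfl] at h1
      -- Capping below the maximum strictly lowers the total under the integer `r(M)`, so strictness
      -- survives the floor; at earlier levels both floors may agree.
      have h2 := mul_lt_mul_of_pos_left (hs hj hkk (Nat.lt_succ_self j)) (hnpos _ hkk)
      rw [Nat.add_sub_cancel, hck]
      have h3 : (c j : ℝ) < rk M M.E := by linarith
      exact_mod_cast h3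
  · intro i hi
    rw [hrE i hi]
    refine ⟨?_, hrc i hi⟩
    rw [hc i hi, hb i hi, hrE i hi]
    push_cast
    ring
  · intro i hi t ht1 ht2
    -- The cap solving `r i + v * n i = t`.
    set v : ℝ := ((t : ℝ) - r i) / n i with hv
    have hn0 := hnpos i hi
    have hvn : v * n i = t - r i := div_mul_cancel₀ _ hn0.ne'
    have hvs : v ≤ s i := by
      rw [hv, div_le_iff₀ hn0]
      have h1 := hcle i hi
      have h2 : (t : ℝ) ≤ c i := by exact_mod_cast ht2
      linarith
    have hv0 : 0 ≤ v := by
      have h1 : (r i : ℝ) ≤ t := by exact_mod_cast (hrc i hi).trans ht1.le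
      exact div_nonneg (by linarith) hn0.le
    have hlt : ∀ e ∈ M.E, η e < s i → η e < v := by
      intro e he hes
      obtain ⟨j, hj, hje⟩ := hval e he
      rw [← hje, hs.lt_iff_lt hj hi] at hes
      obtain ⟨l, rfl⟩ : ∃ l, i = l + 1 := ⟨i - 1, by omega⟩
      have hj1 := hj.1
      have hl : l ∈ Set.Icc 1 k := ⟨by omega, by have := hi.2; omega⟩
      have h1 : η e ≤ s l := by
        rw [← hje, hs.le_iff_le hj hl]
        omega
      refine h1.trans_lt ?_
      rw [hv, lt_div_iff₀ hn0]
      have h2 := hclt l hl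
      rw [hstep l hl.1 hi.2] at h2
      rw [Nat.add_sub_cancel] at ht1
      -- Integrality: `t ≥ c l + 1` exceeds the total capped at `s l`, which forces the cap above `s
      -- l`.
      have h3 : (c l : ℝ) + 1 ≤ t := by exact_mod_cast ht1
      linarith
    have hge : ∀ e ∈ M.E, v ≤ η e ↔ s i ≤ η e := fun e he =>
      ⟨fun hle => le_of_not_gt fun h' => (hlt e he h').not_ge hle, hvs.trans⟩
    have htight : IsLevelTight (truncation M t) (fun e => min (η e) v) := by
      refine h.truncation hv0 ?_
      rw [sum_min_eq h hvs hlt]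
      change (r i : ℝ) + v * n i = t
      rw [hvn]
      ring
    refine ⟨⟨_, htight.isUniversalDensity, ?_, ?_⟩, ?_⟩
    · intro e he
      rw [hE i hi] at he
      rw [hrE i hi, hnE i hi]
      exact min_eq_right (hvs.trans he.2)
    · intro e he
      rw [hE i hi] at he
      exact min_eq_left (hlt e he.1 (lt_of_not_ge fun h' => he.2 ⟨he.1, h'⟩)).le
    · rw [principalPartition_eq htight]
      have hEi : {e ∈ M.E | min (η e) v = v} = E i := by
        ext e
        simp only [hE i hi, mem_ofPred_eq, min_eq_right_iff]
        exact and_congr_right fun he => hge e he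
      have hlev : ∀ a < v, {e ∈ M.E | min (η e) v = a} = {e ∈ M.E | η e = a} := by
        intro a ha
        ext e
        simp only [mem_ofPred_eq, and_congr_right_iff]
        intro _
        rcases le_total (η e) v with h' | h'
        · rw [min_eq_left h']
        · rw [min_eq_right h']
          exact ⟨fun h2 => by linarith, fun h2 => by linarith⟩
      ext P
      simp only [truncation_ground, mem_ofPred_eq, mem_insert_iff, mem_image]
      constructor
      · rintro ⟨⟨e, he⟩, μ, rfl⟩
        obtain ⟨heE, heμ⟩ := he
        -- Levels below the cap are unchanged, while all levels from `s i` upward merge into `E i`.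
        rcases lt_or_ge (η e) v with h' | h'
        · right
          obtain ⟨j, hj, hje⟩ := hval e heE
          rw [min_eq_left h'.le] at heμ
          refine ⟨j, ⟨hj.1, ?_⟩, ?_⟩
          · rw [← hs.lt_iff_lt hj hi, hje]
            exact h'.trans_le hvs
          · rw [hje, ← heμ, hlev _ h']
        · left
          rw [← heμ, min_eq_right h', hEi]
      · rintro (rfl | ⟨j, hj, rfl⟩)
        · refine ⟨?_, v, hEi.symm⟩
          obtain ⟨e, he, hes⟩ := hwit i hi
          rw [hE i hi]
          exact ⟨e, he, hes.ge⟩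
        · have hj' : j ∈ Set.Icc 1 k := ⟨hj.1, hj.2.le.trans hi.2⟩
          obtain ⟨e, he, hes⟩ := hwit j hj'
          refine ⟨⟨e, he, hes⟩, s j, (hlev _ ?_).symm⟩
          rw [← hes]
          exact hlt e he (hes ▸ hs hj' hi hj.2)
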